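/- A function $\omega:\mathbf R\to[0,\infty)$ is called a weight function if it is continuous, even, non-decreasing on $[0,\infty)$, satisfies $\omega(0)=0$, and $(\alpha)$ $\omega(2t)=O(\omega(t))$ as $t\to\infty$; $(\beta)$ $\omega(t)=O(t)$ as $t\to\infty$; $(\gamma)$ $\ln t=o(\omega(t))$ as $t\to\infty$; $(\delta)$ $x\mapsto\omega(e^x)$ is convex on $\mathbf R$. Two functions $f,g:\mathbf R\to\mathbf R$ are called equivalent if $f=O(g)$ and $g=O(f)$ as $|t|\to\infty$. Write $\ln_+x=\max\{0,\ln x\}$ for $x>0$. Let $s>1$. Then the function $$\omega(t)=\frac{\ln_+^{s}|t|}{\ln^{s-1}(\ln(e+|t|))}\quad(t\neq0),\qquad \omega(0)=0,$$ is equivalent to a weight function; that is, there is a weight function $\omega_0$ such that $\omega=O(\omega_0)$ and $\omega_0=O(\omega)$ as $|t|\to\infty$. -/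

import Mathlib

open Filter Asymptotics
open scoped Topology

/-- Weight functions in the sense of Bonet, Meise and Melikhov: non-negative, continuous, even
functions on the real line, increasing on the half line `[0, ∞)` (in the wide sense, since for
example `(max 0 (log |t|)) ^ s` is a weight function), vanishing at `0`, with the conditions
`(α)`, `(β)`, `(γ)`, `(δ)`. -/
structure IsWeightFunction (ω : ℝ → ℝ) : Prop where
  nonneg : ∀ t, 0 ≤ ω t
  continuous : Continuous ω
  even : ∀ t, ω (-t) = ω t
  monotoneOn : MonotoneOn ω (Set.Ici 0)
  map_zero : ω 0 = 0
  alpha : (fun t => ω (2 * t)) =O[atTop] ω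
  beta : ω =O[atTop] (fun t => t)
  gamma : Real.log =o[atTop] ω
  delta : ConvexOn ℝ Set.univ (fun x => ω (Real.exp x))

/-- Equivalence of functions on the real line: `f = O(g)` and `g = O(f)` as `|t| → ∞`. -/
def EquivFun (f g : ℝ → ℝ) : Prop :=
  f =O[cocompact ℝ] g ∧ g =O[cocompact ℝ] f

/-- `ln₊ x = max {0, ln x}`, used for `x > 0` only. -/
noncomputable def lnPlus (x : ℝ) : ℝ := max 0 (Real.log x)

/-- `ω(t) = ln₊^s |t| / ln^{s-1} (ln (e + |t|))` for `t ≠ 0`, and `ω(0) = 0`. -/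
noncomputable def omegaLog (s : ℝ) (t : ℝ) : ℝ :=
  if t = 0 then 0
  else lnPlus |t| ^ s / Real.log (Real.log (Real.exp 1 + |t|)) ^ (s - 1)

/-! Put x = ln|t|. For large x, ln(e + e^x) is close to x, so the inner logarithm can be replaced by
e + x at the cost of bounded factors. The result x^s / ln^{s-1}(e + x) is convex for a structural
reason: the perspective y(x/y)^s is jointly convex and non-increasing in y, and y = ln(e + x) is
concave (`convexOn_logPerspective`). Convexity also yields monotonicity, and substituting x = max(0,
ln|t|) yields a weight function. -/

/-- `x ^ s / ln (e + x) ^ (s - 1)`: the perspective `y * (x / y) ^ s` of the power function,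
evaluated at `y = ln (e + x)`. -/
noncomputable def logPerspective (s x : ℝ) : ℝ :=
  x ^ s / Real.log (Real.exp 1 + x) ^ (s - 1)

theorem one_le_log_exp_one_add {x : ℝ} (hx : 0 ≤ x) : 1 ≤ Real.log (Real.exp 1 + x) := by
  rw [Real.le_log_iff_exp_le (by positivity)]
  linarith

theorem logPerspective_nonneg (s : ℝ) {x : ℝ} (hx : 0 ≤ x) : 0 ≤ logPerspective s x := by
  have := one_le_log_exp_one_add hx
  unfold logPerspective
  positivity

theorem logPerspective_zero {s : ℝ} (hs : s ≠ 0) : logPerspective s 0 = 0 := by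
  simp [logPerspective, Real.zero_rpow hs]

theorem rpow_div_rpow_sub_one {s x y : ℝ} (hx : 0 ≤ x) (hy : 0 < y) :
    x ^ s / y ^ (s - 1) = y * (x / y) ^ s := by
  have : 0 < y ^ s := Real.rpow_pos_of_pos hy s
  rw [Real.div_rpow hx hy.le, Real.rpow_sub_one hy.ne']
  field_simp

/-- Joint convexity of the perspective `x ^ s / y ^ (s - 1)`. -/
theorem rpow_div_rpow_sub_one_convex {s : ℝ} (hs : 1 ≤ s) {x₁ x₂ y₁ y₂ a b : ℝ}
    (hx₁ : 0 ≤ x₁) (hx₂ : 0 ≤ x₂) (hy₁ : 0 < y₁) (hy₂ : 0 < y₂)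
    (ha : 0 ≤ a) (hb : 0 ≤ b) (hab : a + b = 1) :
    (a * x₁ + b * x₂) ^ s / (a * y₁ + b * y₂) ^ (s - 1) ≤
      a * (x₁ ^ s / y₁ ^ (s - 1)) + b * (x₂ ^ s / y₂ ^ (s - 1)) := by
  have hy : 0 < a * y₁ + b * y₂ := by
    rcases ha.eq_or_lt with rfl | ha'
    · have : b = 1 := by linarith
      subst this
      linarith
    · positivity
  -- Jensen at the points x_i / y_i, with weights proportional to a y₁ and b y₂.
  have key := (convexOn_rpow hs).2 (Set.mem_Ici.2 (div_nonneg hx₁ hy₁.le))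
    (Set.mem_Ici.2 (div_nonneg hx₂ hy₂.le))
    (by positivity : 0 ≤ a * y₁ / (a * y₁ + b * y₂))
    (by positivity : 0 ≤ b * y₂ / (a * y₁ + b * y₂)) (by field_simp)
  simp only [smul_eq_mul] at key
  have hc : a * y₁ / (a * y₁ + b * y₂) * (x₁ / y₁) + b * y₂ / (a * y₁ + b * y₂) * (x₂ / y₂) =
      (a * x₁ + b * x₂) / (a * y₁ + b * y₂) := by
    field_simp
  rw [hc] at key
  rw [rpow_div_rpow_sub_one (by positivity) hy, rpow_div_rpow_sub_one hx₁ hy₁,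
    rpow_div_rpow_sub_one hx₂ hy₂]
  calc _ ≤ _ := mul_le_mul_of_nonneg_left key hy.le
    _ = _ := by field_simp

theorem convexOn_logPerspective {s : ℝ} (hs : 1 ≤ s) :
    ConvexOn ℝ (Set.Ici 0) (logPerspective s) := by
  refine ⟨convex_Ici 0, fun x₁ hx₁ x₂ hx₂ a b ha hb hab => ?_⟩
  simp only [Set.mem_Ici] at hx₁ hx₂
  simp only [smul_eq_mul]
  have h₁ := one_le_log_exp_one_add hx₁
  have h₂ := one_le_log_exp_one_add hx₂
  have e := Real.exp_pos 1
  have hconc := strictConcaveOn_log_Ioi.concaveOn.2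
    (Set.mem_Ioi.2 (by positivity : 0 < Real.exp 1 + x₁))
    (Set.mem_Ioi.2 (by positivity : 0 < Real.exp 1 + x₂)) ha hb hab
  have hsum : a • (Real.exp 1 + x₁) + b • (Real.exp 1 + x₂) =
      Real.exp 1 + (a * x₁ + b * x₂) := by
    simp only [smul_eq_mul]
    linear_combination Real.exp 1 * hab
  rw [hsum] at hconc
  simp only [smul_eq_mul] at hconc
  have hpos : 0 < a * Real.log (Real.exp 1 + x₁) + b * Real.log (Real.exp 1 + x₂) := by
    nlinarith
  -- By concavity of the logarithm, passing to the averaged denominator only increases the quotient.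
  refine le_trans ?_ (rpow_div_rpow_sub_one_convex hs hx₁ hx₂ (by linarith) (by linarith)
    ha hb hab)
  unfold logPerspective
  have : 0 ≤ s - 1 := by linarith
  gcongr

/-- A convex f ≥ 0 with f(0) = 0 satisfies f(x) ≤ (x/y) f(y) ≤ f(y) for 0 ≤ x ≤ y, y > 0. -/
theorem monotoneOn_logPerspective {s : ℝ} (hs : 1 ≤ s) :
    MonotoneOn (logPerspective s) (Set.Ici 0) := by
  intro x hx y hy hxy
  simp only [Set.mem_Ici] at hx hy
  rcases hy.eq_or_lt with rfl | hy'
  · rw [le_antisymm hxy hx]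
  have hxy' : x / y ≤ 1 := (div_le_one hy').2 hxy
  have h := (convexOn_logPerspective hs).2 (Set.mem_Ici.2 le_rfl) (Set.mem_Ici.2 hy)
    (by linarith : 0 ≤ 1 - x / y) (by positivity : 0 ≤ x / y) (by ring)
  simp only [smul_eq_mul, mul_zero, zero_add, logPerspective_zero (by linarith : s ≠ 0),
    div_mul_cancel₀ x hy'.ne'] at h
  exact h.trans (mul_le_of_le_one_left (logPerspective_nonneg s hy) hxy')

theorem logPerspective_le_rpow {s x : ℝ} (hs : 1 ≤ s) (hx : 0 ≤ x) :
    logPerspective s x ≤ x ^ s :=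
  div_le_self (by positivity)
    (Real.one_le_rpow (one_le_log_exp_one_add hx) (by linarith))

/-- Gives (α) with c = ln 2: c + x ≤ 2x in the numerator, while the denominator only grows. -/
theorem logPerspective_add_le {s x c : ℝ} (hs : 1 ≤ s) (hc : 0 ≤ c) (hx : c ≤ x) :
    logPerspective s (c + x) ≤ 2 ^ s * logPerspective s x := by
  have hx0 : 0 ≤ x := hc.trans hx
  have h := one_le_log_exp_one_add hx0
  have hs' : 0 ≤ s - 1 := by linarith
  have e := Real.exp_pos 1
  unfold logPerspective
  rw [← mul_div_assoc, ← Real.mul_rpow (by norm_num) hx0]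
  gcongr <;> linarith

/-- Condition (γ) in the variable x: the quotient is (ln(e + x) / x)^{s-1}, which tends to 0 because
s > 1. -/
theorem isLittleO_id_logPerspective {s : ℝ} (hs : 1 < s) :
    (fun x : ℝ => x) =o[atTop] logPerspective s := by
  have hlog : (fun x : ℝ => Real.log (Real.exp 1 + x)) =o[atTop] (fun x : ℝ => x) := by
    have h := Real.isLittleO_log_id_atTop.comp_tendsto
      (tendsto_atTop_add_const_left atTop (Real.exp 1) tendsto_id)
    refine h.trans_isBigO ?_
    refine IsBigO.of_bound 2 ?_
    filter_upwards [eventually_ge_atTop (Real.exp 1)] with x hx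
    have e := Real.exp_pos 1
    simp only [Function.comp, id, Real.norm_eq_abs]
    rw [abs_of_pos (by linarith), abs_of_pos (by linarith)]
    linarith
  have hpow := (hlog.tendsto_div_nhds_zero.rpow_const (p := s - 1) (Or.inr (by linarith)))
  rw [Real.zero_rpow (by linarith)] at hpow
  refine (isLittleO_iff_tendsto' ?_).2 (hpow.congr' ?_)
  · filter_upwards [eventually_gt_atTop 0] with x hx h
    have := one_le_log_exp_one_add hx.le
    have : 0 < logPerspective s x := by unfold logPerspective; positivity
    exact absurd h this.ne'
  · filter_upwards [eventually_gt_atTop 0] with x hx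
    have h := one_le_log_exp_one_add hx.le
    have hxs : 0 < x ^ s := by positivity
    have hL : 0 < Real.log (Real.exp 1 + x) ^ (s - 1) := by positivity
    rw [Real.div_rpow (by linarith) hx.le, Real.rpow_sub_one hx.ne']
    unfold logPerspective
    field_simp

/-- The weight function equivalent to `omegaLog s`. -/
noncomputable def logWeight (s t : ℝ) : ℝ := logPerspective s (Real.log (max 1 |t|))

theorem log_max_one_nonneg (t : ℝ) : 0 ≤ Real.log (max 1 |t|) :=
  Real.log_nonneg (le_max_left _ _)

theorem logWeight_of_one_le {s t : ℝ} (ht : 1 ≤ t) :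
    logWeight s t = logPerspective s (Real.log t) := by
  rw [logWeight, abs_of_pos (by linarith), max_eq_right ht]

theorem continuous_logWeight {s : ℝ} (hs : 1 < s) : Continuous (logWeight s) := by
  have hx : Continuous fun t : ℝ => Real.log (max 1 |t|) :=
    (continuous_const.max continuous_abs).log fun t => by positivity
  have hL (t : ℝ) := one_le_log_exp_one_add (log_max_one_nonneg t)
  have hpos (t : ℝ) : Real.exp 1 + Real.log (max 1 |t|) ≠ 0 := by
    have := log_max_one_nonneg t
    positivity
  unfold logWeight logPerspective
  refine (hx.rpow_const fun t => Or.inr (by linarith)).div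
    (((continuous_const.add hx).log hpos).rpow_const fun t => Or.inr (by linarith)) fun t => ?_
  exact (Real.rpow_pos_of_pos (by linarith [hL t]) _).ne'

theorem isWeightFunction_logWeight {s : ℝ} (hs : 1 < s) : IsWeightFunction (logWeight s) where
  nonneg t := logPerspective_nonneg s (log_max_one_nonneg t)
  continuous := continuous_logWeight hs
  even t := by simp [logWeight]
  monotoneOn x hx y hy hxy := by
    refine monotoneOn_logPerspective hs.le (log_max_one_nonneg x) (log_max_one_nonneg y) ?_
    refine Real.log_le_log (by positivity) (max_le_max le_rfl ?_)
    rwa [abs_of_nonneg hx, abs_of_nonneg hy]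
  map_zero := by simp [logWeight, logPerspective_zero (by linarith : s ≠ 0)]
  alpha := by
    refine IsBigO.of_bound (2 ^ s) ?_
    filter_upwards [eventually_ge_atTop 2] with t ht
    rw [logWeight_of_one_le (by linarith), logWeight_of_one_le (by linarith),
      Real.norm_of_nonneg (logPerspective_nonneg s (Real.log_nonneg (by linarith))),
      Real.norm_of_nonneg (logPerspective_nonneg s (Real.log_nonneg (by linarith))),
      Real.log_mul (by norm_num) (by linarith)]
    exact logPerspective_add_le hs.le (Real.log_nonneg (by norm_num))
      (Real.log_le_log (by norm_num) ht)
  beta := by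
    have h : (fun t : ℝ => Real.log t ^ s) =o[atTop] (fun t : ℝ => t) := by
      simpa using isLittleO_log_rpow_rpow_atTop s one_pos
    refine IsBigO.trans (IsBigO.of_bound 1 ?_) h.isBigO
    filter_upwards [eventually_ge_atTop 1] with t ht
    have hl := Real.log_nonneg ht
    rw [logWeight_of_one_le ht, Real.norm_of_nonneg (logPerspective_nonneg s hl),
      Real.norm_of_nonneg (Real.rpow_nonneg hl s), one_mul]
    exact logPerspective_le_rpow hs.le hl
  gamma := by
    refine ((isLittleO_id_logPerspective hs).comp_tendsto Real.tendsto_log_atTop).congr'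
      EventuallyEq.rfl ?_
    filter_upwards [eventually_ge_atTop 1] with t ht
    rw [logWeight_of_one_le ht, Function.comp]
  delta := by
    have hmax (x : ℝ) : Real.log (max 1 |Real.exp x|) = max 0 x := by
      rw [abs_of_pos (Real.exp_pos x), ← Real.exp_zero, ← Real.exp_monotone.map_max,
        Real.log_exp]
    refine ⟨convex_univ, fun x _ y _ a b ha hb hab => ?_⟩
    simp only [logWeight, hmax]
    have hx : 0 ≤ max 0 x := le_max_left _ _
    have hy : 0 ≤ max 0 y := le_max_left _ _
    -- A convex non-decreasing function composed with the convex map x ↦ max(0, x).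
    refine le_trans (monotoneOn_logPerspective hs.le (Set.mem_Ici.2 (le_max_left _ _)) (Set.mem_Ici.2 ?_) ?_)
      ((convexOn_logPerspective hs.le).2 hx hy ha hb hab)
    · simp only [smul_eq_mul]; positivity
    · simp only [smul_eq_mul]
      refine max_le (by positivity) ?_
      gcongr <;> exact le_max_right _ _

theorem log_log_exp_one_add_exp_le {x : ℝ} (hx : 1 ≤ x) :
    Real.log (Real.log (Real.exp 1 + Real.exp x)) ≤ Real.log (Real.exp 1 + x) := by
  have e := Real.exp_one_gt_two
  refine Real.log_le_log ?_ ?_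
  · linarith [one_le_log_exp_one_add (Real.exp_pos x).le]
  · rw [Real.log_le_iff_le_exp (by positivity), Real.exp_add]
    have h1 : Real.exp 1 ≤ Real.exp x := Real.exp_le_exp.2 hx
    have h2 : 2 ≤ Real.exp (Real.exp 1) := by linarith [Real.add_one_le_exp (Real.exp 1)]
    -- e + e^x ≤ 2e^x ≤ e^e · e^x.
    nlinarith [Real.exp_pos x]

theorem log_exp_one_add_le {x : ℝ} (hx : 3 ≤ x) :
    Real.log (Real.exp 1 + x) ≤ 2 * Real.log (Real.log (Real.exp 1 + Real.exp x)) := by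
  have e := Real.exp_one_lt_d9
  have e0 := Real.exp_pos 1
  have h : x ≤ Real.log (Real.exp 1 + Real.exp x) := by
    rw [Real.le_log_iff_exp_le (by positivity)]
    linarith
  -- The bound x ≥ 3 ensures e + x ≤ x²; it is the source of the threshold e³ for |t|.
  calc Real.log (Real.exp 1 + x) ≤ Real.log (x ^ 2) :=
        Real.log_le_log (by positivity) (by nlinarith)
    _ = 2 * Real.log x := by simp [Real.log_pow]
    _ ≤ _ := by
      have := Real.log_le_log (by linarith) h
      linarith

theorem logWeight_le_omegaLog_and_le {s t : ℝ} (hs : 1 ≤ s) (ht : Real.exp 3 ≤ |t|) :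
    logWeight s t ≤ omegaLog s t ∧ omegaLog s t ≤ 2 ^ (s - 1) * logWeight s t := by
  have ht0 : 0 < |t| := (Real.exp_pos 3).trans_le ht
  have hx : 3 ≤ Real.log |t| := (Real.le_log_iff_exp_le ht0).2 ht
  have h1 : 1 ≤ |t| := by linarith [Real.add_one_le_exp (3 : ℝ)]
  have hs' : 0 ≤ s - 1 := by linarith
  have hL := one_le_log_exp_one_add (by linarith : 0 ≤ Real.log |t|)
  have hle := log_log_exp_one_add_exp_le (by linarith : 1 ≤ Real.log |t|)
  have hge := log_exp_one_add_le hx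
  rw [Real.exp_log ht0] at hle hge
  have hM : 0 < Real.log (Real.log (Real.exp 1 + |t|)) := by linarith
  have hx0 : 0 ≤ Real.log |t| := by linarith
  rw [logWeight, max_eq_right h1, omegaLog, if_neg (abs_pos.1 ht0), lnPlus,
    max_eq_right hx0, logPerspective]
  refine ⟨by gcongr, ?_⟩
  rw [← mul_div_assoc, div_le_div_iff₀ (by positivity) (by positivity), mul_comm (2 ^ (s - 1)),
    mul_assoc, ← Real.mul_rpow (by norm_num) hM.le]
  gcongr

theorem equivFun_omegaLog_logWeight {s : ℝ} (hs : 1 ≤ s) :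
    EquivFun (omegaLog s) (logWeight s) := by
  have hev : ∀ᶠ t : ℝ in cocompact ℝ, Real.exp 3 ≤ |t| :=
    (tendsto_norm_cocompact_atTop (E := ℝ)).eventually_ge_atTop (Real.exp 3)
  have hnn (t : ℝ) : 0 ≤ logWeight s t := logPerspective_nonneg s (log_max_one_nonneg t)
  constructor
  · refine IsBigO.of_bound (2 ^ (s - 1)) (hev.mono fun t ht => ?_)
    obtain ⟨h1, h2⟩ := logWeight_le_omegaLog_and_le hs ht
    rwa [Real.norm_of_nonneg (hnn t), Real.norm_of_nonneg ((hnn t).trans h1)]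
  · refine IsBigO.of_bound 1 (hev.mono fun t ht => ?_)
    obtain ⟨h1, h2⟩ := logWeight_le_omegaLog_and_le hs ht
    rwa [Real.norm_of_nonneg (hnn t), Real.norm_of_nonneg ((hnn t).trans h1), one_mul]

theorem mainTheorem3 (s : ℝ) (hs : 1 < s) :
    ∃ ω₀ : ℝ → ℝ, IsWeightFunction ω₀ ∧ EquivFun (omegaLog s) ω₀ :=
  ⟨logWeight s, isWeightFunction_logWeight hs, equivFun_omegaLog_logWeight hs.le⟩
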